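/- A Lie group is a finite-dimensional real Lie group. A topological group is an inverse limit of Lie groups if it is isomorphic, as a topological group, to the limit $\varprojlim_{i\in I} G_i$ of an inverse system of Lie groups and continuous homomorphisms over a nonempty directed set $I$. For subgroups $K\le H$ of a group, $[H:K]$ denotes the cardinality of the coset space $H/K$. Theorem. Let $G$ be a Polish group and let $H\le G$ be a compact subgroup. (1) If $G$ is an inverse limit of Lie groups, then for every $x\in G$ $$[H: H\cap xHx^{-1}]=[H: H\cap x^{-1}Hx]\in \mathbb N_{\ge 1}\cup\{2^{\aleph_0}\}.$$ (2) If $H$, with the topology induced from $G$, is a Lie group, then for every $x\in G$ $$[H: H\cap xHx^{-1}]=[H: H\cap x^{-1}Hx].$$ -/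

import Mathlib

open scoped Manifold ContDiff

universe u v w

/-- A group with a topology is a (real, finite-dimensional) Lie group: for some `n` it carries,
for its given topology, an atlas of charts in `ℝⁿ` that makes it a smooth (boundaryless) manifold
with smooth multiplication and inversion. The Hausdorff property follows from these
conditions; second countability is not required, so that every discrete group is a Lie group. -/
def IsRealLieGroup (G : Type u) [Group G] [TopologicalSpace G] : Prop :=
  ∃ (n : ℕ) (_ : ChartedSpace (EuclideanSpace ℝ (Fin n)) G),
    LieGroup 𝓘(ℝ, EuclideanSpace ℝ (Fin n)) ∞ G

/-- The inverse limit of a family of topological groups `L i` along continuous homomorphisms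
`f : L j → L i` for `i ≤ j`: the subgroup of the product formed by the compatible families. It
carries the subspace topology of the product topology. -/
def inverseLimit {ι : Type v} [Preorder ι] (L : ι → Type w) [∀ i, Group (L i)]
    [∀ i, TopologicalSpace (L i)] (f : ∀ ⦃i j : ι⦄, i ≤ j → (L j →ₜ* L i)) :
    Subgroup (∀ i, L i) where
  carrier := {a | ∀ ⦃i j : ι⦄ (h : i ≤ j), f h (a j) = a i}
  one_mem' := fun _ _ h => map_one (f h)
  mul_mem' := fun {a b} ha hb i j h => by
    simp only [Pi.mul_apply, map_mul, ha h, hb h]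
  inv_mem' := fun {a} ha i j h => by
    simp only [Pi.inv_apply, map_inv, ha h]

/-- `G` is an inverse limit of Lie groups: it is isomorphic, as a topological group, to the inverse
limit of an inverse system of Lie groups and continuous homomorphisms, indexed by a nonempty
directed set. The transition maps need not be surjective. -/
def IsInverseLimitOfLieGroups (G : Type u) [Group G] [TopologicalSpace G] : Prop :=
  ∃ (ι : Type v) (_ : Preorder ι) (L : ι → Type w) (_ : ∀ i, Group (L i))
    (_ : ∀ i, TopologicalSpace (L i)) (f : ∀ ⦃i j : ι⦄, i ≤ j → (L j →ₜ* L i)),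
    Nonempty ι ∧ IsDirected ι (· ≤ ·) ∧ (∀ i, IsRealLieGroup (L i)) ∧
    (∀ (i : ι) (a : L i), f (le_refl i) a = a) ∧
    (∀ (i j k : ι) (hij : i ≤ j) (hjk : j ≤ k) (a : L k),
      f hij (f hjk a) = f (hij.trans hjk) a) ∧
    Nonempty (G ≃ₜ* inverseLimit L f)

/-- The conjugate subgroup `x H x⁻¹`. -/
def conjSubgroup {G : Type u} [Group G] (x : G) (H : Subgroup G) : Subgroup G :=
  H.map (MulAut.conj x).toMonoidHom

/-- The index `[H : K]` as a cardinal number, the cardinality of the coset space `H / K`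
(used for `K ≤ H`). -/
noncomputable def cardIndex {G : Type u} [Group G] (H K : Subgroup G) : Cardinal.{u} :=
  Cardinal.mk (H ⧸ K.subgroupOf H)

/-- The index condition: `[H : H ∩ x H x⁻¹] = [H : H ∩ x⁻¹ H x]` for all `x`, as cardinals. -/
def IndexCondition {G : Type u} [Group G] (H : Subgroup G) : Prop :=
  ∀ x : G, cardIndex H (H ⊓ conjSubgroup x H) = cardIndex H (H ⊓ conjSubgroup x⁻¹ H)

/-- The set `ℕ≥1 ∪ {2^ω}` of cardinal numbers. -/
def posNatOrContinuum : Set Cardinal.{u} :=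
  {c | ∃ n : ℕ, 1 ≤ n ∧ c = (n : Cardinal.{u})} ∪ {Cardinal.continuum.{u}}

/-!
Write `K = H ∩ xHx⁻¹` and `K' = H ∩ x⁻¹Hx = x⁻¹Kx`.

*Cardinals.* `H` is compact and metrizable, so by Baire's theorem the coset space of a closed
subgroup is either finite or an uncountable Polish space, hence of cardinality `2^ω`
(`mk_quotient_eq_continuum_of_infinite`). It remains to see that `[H : K] = [H : K']` as soon as
`[H : K]` is finite.

*The Lie case.* Suppose that `H` is a compact group whose closed subgroups satisfy the descending
chain condition. Then `H` has a least closed subgroup `M` of finite index. If `[H : K]` is finite,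
then `M ≤ K`, and conjugation by `x⁻¹` maps `M` into `M`. The iterated images of `M` form a
descending chain, so the image of `M` is `M` itself, and
`[H : K] = [H : M] / [K : M] = [H : M] / [K' : M] = [H : K']`
(`IsApproxAdditive.relIndex_conj_smul_eq`).

*The chain condition.* All that is needed of a Lie group is a chart `φ` at `1` in which
multiplication is addition up to an error `‖φ g‖ * ‖φ h‖` (`IsApproxAdditive`). Such a chart
restricts to all subgroups, so it is available on compact subgroups of Lie groups without knowing
that these are Lie groups. As in the proof of Cartan's closed subgroup theorem, a closed subgroup
`D` of a compact group has a tangent space at `1`, a linear subspace which contains all limits of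
directions of elements of `D` converging to `1`. If `D' ≤ D` has the same tangent space as `D`, it
contains a neighbourhood of `1` in `D` (`IsApproxAdditive.exists_forall_norm_lt_mem`), and the
tangent space of a decreasing intersection is the intersection of the tangent spaces
(`IsApproxAdditive.iInf_tangentSpace_le`). Since the tangent spaces have finite dimension, they
stabilise along a descending chain of closed subgroups; the intersection of the chain is then open
in some member, hence equal to a later one by compactness. No exponential map is used: powers of
small elements take the place of one-parameter subgroups.

*Inverse limits.* The projections of `G` to the Lie groups `L i` map `H`, `K`, `K'` to compact
subgroups, for which the indices of the images of `K` and `K'` agree by the Lie case. By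
compactness, the index of `K'` in `H` is attained by the images in some `L i`
(`Subgroup.exists_relIndex_eq_relIndex_map`), so `[H : K'] ≤ [H : K]`; exchange `x` and `x⁻¹`.
-/

open Filter Topology
open scoped Pointwise

/-! ### Approximately additive maps -/

/-- A map `φ` from a topological group to a normed space is *approximately additive* if it pulls
the neighbourhoods of `0` back to exactly the neighbourhoods of `1`, and is additive up to an error
`‖φ g‖ * ‖φ h‖` on the part of the group where `‖φ‖ ≤ 1`. A `C²` chart of a Lie group that sends `1`
to `0` has this property after rescaling; the values of `φ` far from `1` are irrelevant as long as
they have norm larger than `1`, so `φ` is a total function that need not be continuous. -/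
structure IsApproxAdditive {Γ E : Type*} [Group Γ] [TopologicalSpace Γ] [NormedAddCommGroup E]
    (φ : Γ → E) : Prop where
  nhds_one : 𝓝 (1 : Γ) = comap φ (𝓝 0)
  norm_map_mul_sub_le : ∀ g h, ‖φ g‖ ≤ 1 → ‖φ h‖ ≤ 1 → ‖φ (g * h) - φ g - φ h‖ ≤ ‖φ g‖ * ‖φ h‖

namespace IsApproxAdditive

section Basic

variable {Γ E : Type*} [Group Γ] [TopologicalSpace Γ] [NormedAddCommGroup E] {φ : Γ → E}

lemma subgroup (hφ : IsApproxAdditive φ) (H : Subgroup Γ) :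
    IsApproxAdditive (fun h : H => φ h) where
  nhds_one := by
    rw [nhds_subtype_eq_comap, Subgroup.coe_one, hφ.nhds_one, comap_comap]
    rfl
  norm_map_mul_sub_le g h hg hh := hφ.norm_map_mul_sub_le g h hg hh

lemma map_one (hφ : IsApproxAdditive φ) : φ 1 = 0 := by
  have h : Tendsto φ (pure 1) (𝓝 0) :=
    tendsto_iff_comap.2 ((pure_le_nhds 1).trans hφ.nhds_one.le)
  by_contra hne
  have := tendsto_pure_left.1 h _ (isOpen_compl_singleton.mem_nhds (x := (0 : E))
    (s := {φ 1}ᶜ) (Ne.symm hne))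
  exact this rfl

lemma tendsto (hφ : IsApproxAdditive φ) : Tendsto φ (𝓝 1) (𝓝 0) :=
  tendsto_iff_comap.2 hφ.nhds_one.le

lemma eventually_norm_lt (hφ : IsApproxAdditive φ) {ε : ℝ} (hε : 0 < ε) :
    ∀ᶠ g in 𝓝 (1 : Γ), ‖φ g‖ < ε := by
  simpa using hφ.tendsto.eventually (Metric.ball_mem_nhds 0 hε)

/-- The sets `{g | ‖φ g‖ < ε}` form a basis of neighbourhoods of `1`. -/
lemma exists_forall_norm_lt (hφ : IsApproxAdditive φ) {p : Γ → Prop} (hp : ∀ᶠ g in 𝓝 1, p g) :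
    ∃ ε > 0, ∀ g, ‖φ g‖ < ε → p g := by
  have hb := (Metric.nhds_basis_ball (x := (0 : E))).comap φ
  rw [← hφ.nhds_one] at hb
  obtain ⟨ε, hε, h⟩ := hb.eventually_iff.1 hp
  exact ⟨ε, hε, fun g hg => h (by simpa using hg)⟩

/-- Near `1`, inversion is negation up to a quadratic error. -/
lemma exists_norm_map_inv_add_le [IsTopologicalGroup Γ] (hφ : IsApproxAdditive φ) :
    ∃ ε > 0, ∀ g, ‖φ g‖ < ε → ‖φ g⁻¹ + φ g‖ ≤ 2 * ‖φ g‖ ^ 2 := by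
  have hinv : Tendsto (fun g : Γ => g⁻¹) (𝓝 1) (𝓝 1) := by
    simpa using (continuous_inv (G := Γ)).tendsto 1
  obtain ⟨ε, hε, h⟩ := hφ.exists_forall_norm_lt
    ((hinv.eventually (hφ.eventually_norm_lt (show (0 : ℝ) < 1 / 2 by norm_num))).and
      (hφ.eventually_norm_lt one_pos))
  refine ⟨ε, hε, fun g hg => ?_⟩
  obtain ⟨h1, h2⟩ := h g hg
  have h3 := hφ.norm_map_mul_sub_le g g⁻¹ h2.le (h1.le.trans (by norm_num))
  rw [mul_inv_cancel, hφ.map_one, zero_sub, ← neg_add', norm_neg, add_comm] at h3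
  have h4 : ‖φ g⁻¹‖ ≤ ‖φ g⁻¹ + φ g‖ + ‖φ g‖ := by
    simpa using norm_sub_le (φ g⁻¹ + φ g) (φ g)
  nlinarith [norm_nonneg (φ g), norm_nonneg (φ g⁻¹)]

/-- Right translation by a small element is a small perturbation. -/
lemma norm_map_mul_sub_left_le (hφ : IsApproxAdditive φ) {g h : Γ} (hg : ‖φ g‖ ≤ 1)
    (hh : ‖φ h‖ ≤ 1) : ‖φ (g * h) - φ g‖ ≤ 2 * ‖φ h‖ := by
  have h1 := hφ.norm_map_mul_sub_le g h hg hh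
  have h2 : ‖φ (g * h) - φ g‖ ≤ ‖φ (g * h) - φ g - φ h‖ + ‖φ h‖ := by
    simpa using norm_add_le (φ (g * h) - φ g - φ h) (φ h)
  nlinarith [norm_nonneg (φ h)]

lemma isClosed_norm_sub_le [IsTopologicalGroup Γ] (hφ : IsApproxAdditive φ) {w : E} {q : ℝ}
    (hw : ‖w‖ + q ≤ 1) : IsClosed {g | ‖φ g - w‖ ≤ q} := by
  refine isClosed_of_closure_subset fun g hg => ?_
  change ‖φ g - w‖ ≤ q
  refine le_of_forall_pos_le_add fun ε hε => ?_
  have ht : Tendsto (fun d : Γ => d⁻¹ * g) (𝓝 g) (𝓝 1) := by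
    have : Continuous fun d : Γ => d⁻¹ * g := by fun_prop
    simpa using this.tendsto g
  obtain ⟨d, ⟨h1, h2⟩, hd⟩ := mem_closure_iff_nhds.1 hg _ (ht.eventually
    ((hφ.eventually_norm_lt (half_pos hε)).and (hφ.eventually_norm_lt one_pos)))
  have hd1 : ‖φ d‖ ≤ 1 := by
    have : ‖φ d‖ ≤ ‖φ d - w‖ + ‖w‖ := by simpa using norm_add_le (φ d - w) w
    exact this.trans (by linarith [show ‖φ d - w‖ ≤ q from hd])
  have h3 := hφ.norm_map_mul_sub_left_le hd1 h2.le
  rw [mul_inv_cancel_left] at h3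
  have h4 := norm_add_le (φ g - φ d) (φ d - w)
  rw [sub_add_sub_cancel] at h4
  linarith [show ‖φ d - w‖ ≤ q from hd]

end Basic

/-! ### Tangent spaces of subgroups -/

section Tangent

variable {Γ E : Type*} [Group Γ] [TopologicalSpace Γ] [NormedAddCommGroup E] [NormedSpace ℝ E]
  {φ : Γ → E}

/-- As long as `n * ‖φ g‖` stays small, `φ (g ^ n)` is `n • φ g` up to a quadratic error. -/
lemma norm_map_pow_sub_le (hφ : IsApproxAdditive φ) (g : Γ) (n : ℕ) (hn : n * ‖φ g‖ ≤ 1 / 4) :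
    ‖φ (g ^ n) - (n : ℝ) • φ g‖ ≤ (n * ‖φ g‖) ^ 2 := by
  induction n with
  | zero => simp [hφ.map_one]
  | succ n ih =>
    push_cast at hn ⊢
    have ha := norm_nonneg (φ g)
    have hna : 0 ≤ n * ‖φ g‖ := by positivity
    have ih' := ih (by linarith)
    have h1 : ‖φ (g ^ n)‖ ≤ 2 * (n * ‖φ g‖) := by
      have : ‖φ (g ^ n)‖ ≤ ‖φ (g ^ n) - (n : ℝ) • φ g‖ + ‖(n : ℝ) • φ g‖ := by
        simpa using norm_add_le (φ (g ^ n) - (n : ℝ) • φ g) ((n : ℝ) • φ g)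
      rw [norm_smul, Real.norm_natCast] at this
      nlinarith
    have h2 := hφ.norm_map_mul_sub_le (g ^ n) g (by linarith) (by linarith)
    have h3 : φ (g ^ (n + 1)) - ((n : ℝ) + 1) • φ g =
        (φ (g ^ n * g) - φ (g ^ n) - φ g) + (φ (g ^ n) - (n : ℝ) • φ g) := by
      rw [pow_succ, add_smul, one_smul]; abel
    rw [h3]
    refine (norm_add_le _ _).trans ?_
    nlinarith [mul_le_mul_of_nonneg_right h1 ha]

/-- The vectors `v` such that the ray `r • v` is approximated by elements of `D` to first order as
`r → 0⁺`. -/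
def tangentSet (φ : Γ → E) (D : Subgroup Γ) : Set E :=
  {v | ∀ ε > 0, ∃ δ > 0, ∀ r : ℝ, 0 < r → r < δ → ∃ d ∈ D, ‖φ d - r • v‖ ≤ ε * r}

lemma neg_mem_tangentSet [IsTopologicalGroup Γ] (hφ : IsApproxAdditive φ) {D : Subgroup Γ} {v : E}
    (hv : v ∈ tangentSet φ D) : -v ∈ tangentSet φ D := by
  intro ε hε
  obtain ⟨η, hη, hinv⟩ := hφ.exists_norm_map_inv_add_le
  obtain ⟨δ, hδ, h⟩ := hv (ε / 2) (by positivity)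
  set c : ℝ := ε + ‖v‖ with hc
  have hc0 : 0 < c := by positivity
  refine ⟨min δ (min (η / c) (ε / (4 * c ^ 2))), by positivity, fun r hr hrδ => ?_⟩
  simp only [lt_min_iff] at hrδ
  obtain ⟨h1, h2, h3⟩ := hrδ
  obtain ⟨d, hd, hdr⟩ := h r hr h1
  rw [lt_div_iff₀ (by positivity)] at h2 h3
  have hd1 : ‖φ d‖ ≤ ‖φ d - r • v‖ + ‖r • v‖ := by
    simpa using norm_add_le (φ d - r • v) (r • v)
  rw [norm_smul, Real.norm_of_nonneg hr.le] at hd1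
  have hd2 : ‖φ d‖ ≤ r * c := by rw [hc]; nlinarith
  have hd3 : ‖φ d‖ < η := by
    have : r * c < η := h2
    linarith
  refine ⟨d⁻¹, D.inv_mem hd, ?_⟩
  have h4 : φ d⁻¹ - r • -v = (φ d⁻¹ + φ d) - (φ d - r • v) := by
    rw [smul_neg]; abel
  rw [h4]
  refine (norm_sub_le _ _).trans ?_
  have h5 : ‖φ d‖ ^ 2 ≤ (r * c) ^ 2 := by gcongr
  have h6 : r * (r * (4 * c ^ 2)) ≤ r * ε := by gcongr
  nlinarith [hinv d hd3]

lemma add_mem_tangentSet (hφ : IsApproxAdditive φ) {D : Subgroup Γ} {v w : E}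
    (hv : v ∈ tangentSet φ D) (hw : w ∈ tangentSet φ D) : v + w ∈ tangentSet φ D := by
  intro ε hε
  obtain ⟨δ₁, hδ₁, h₁⟩ := hv (ε / 3) (by positivity)
  obtain ⟨δ₂, hδ₂, h₂⟩ := hw (ε / 3) (by positivity)
  set c : ℝ := ε + ‖v‖ + ‖w‖ with hc
  have hc0 : 0 < c := by positivity
  refine ⟨min (min δ₁ δ₂) (min (1 / c) (ε / (3 * c ^ 2))), by positivity, fun r hr hrδ => ?_⟩
  simp only [lt_min_iff] at hrδ
  obtain ⟨⟨h1, h2⟩, h3, h4⟩ := hrδ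
  rw [lt_div_iff₀ (by positivity)] at h3 h4
  obtain ⟨d, hd, hdr⟩ := h₁ r hr h1
  obtain ⟨e, he, her⟩ := h₂ r hr h2
  have hd1 : ‖φ d‖ ≤ ‖φ d - r • v‖ + ‖r • v‖ := by
    simpa using norm_add_le (φ d - r • v) (r • v)
  have he1 : ‖φ e‖ ≤ ‖φ e - r • w‖ + ‖r • w‖ := by
    simpa using norm_add_le (φ e - r • w) (r • w)
  rw [norm_smul, Real.norm_of_nonneg hr.le] at hd1 he1
  have hd2 : ‖φ d‖ ≤ r * c := by rw [hc]; nlinarith [norm_nonneg w]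
  have he2 : ‖φ e‖ ≤ r * c := by rw [hc]; nlinarith [norm_nonneg v]
  have h5 := hφ.norm_map_mul_sub_le d e (hd2.trans h3.le) (he2.trans h3.le)
  refine ⟨d * e, D.mul_mem hd he, ?_⟩
  have h6 : φ (d * e) - r • (v + w) =
      (φ (d * e) - φ d - φ e) + ((φ d - r • v) + (φ e - r • w)) := by
    rw [smul_add]; abel
  rw [h6]
  refine (norm_add_le _ _).trans ?_
  have h7 := norm_add_le (φ d - r • v) (φ e - r • w)
  have h8 : ‖φ d‖ * ‖φ e‖ ≤ (r * c) * (r * c) := by gcongr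
  have h9 : r * (r * (3 * c ^ 2)) ≤ r * ε := by gcongr
  nlinarith

/-- The tangent space at `1` of a subgroup, seen through an approximately additive map. It is a
linear subspace because products and inverses in the group are sums and negatives to first
order. -/
def tangentSpace [IsTopologicalGroup Γ] (hφ : IsApproxAdditive φ) (D : Subgroup Γ) :
    Submodule ℝ E where
  carrier := tangentSet φ D
  add_mem' := hφ.add_mem_tangentSet
  zero_mem' ε hε := ⟨1, one_pos, fun r hr _ => ⟨1, D.one_mem, by
    rw [hφ.map_one]; simpa using by positivity⟩⟩
  smul_mem' := by
    have hpos : ∀ (c : ℝ) (v : E), 0 < c → v ∈ tangentSet φ D → c • v ∈ tangentSet φ D := by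
      intro c v hc hv ε hε
      obtain ⟨δ, hδ, h⟩ := hv (ε / c) (by positivity)
      refine ⟨δ / c, by positivity, fun r hr hrδ => ?_⟩
      obtain ⟨d, hd, hdr⟩ := h (r * c) (by positivity) ((lt_div_iff₀ hc).1 hrδ)
      refine ⟨d, hd, ?_⟩
      rw [smul_smul]
      refine hdr.trans_eq ?_
      field_simp
    intro c v hv
    rcases lt_trichotomy c 0 with hc | rfl | hc
    · have := hpos (-c) (-v) (neg_pos.2 hc) (hφ.neg_mem_tangentSet hv)
      rwa [neg_smul_neg] at this
    · rw [zero_smul]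
      exact fun ε hε => ⟨1, one_pos, fun r hr _ => ⟨1, D.one_mem, by
        rw [hφ.map_one]; simpa using by positivity⟩⟩
    · exact hpos c v hc hv

lemma mem_tangentSpace [IsTopologicalGroup Γ] (hφ : IsApproxAdditive φ) {D : Subgroup Γ} {v : E} :
    v ∈ hφ.tangentSpace D ↔
      ∀ ε > 0, ∃ δ > 0, ∀ r : ℝ, 0 < r → r < δ → ∃ d ∈ D, ‖φ d - r • v‖ ≤ ε * r :=
  Iff.rfl

lemma tangentSpace_mono [IsTopologicalGroup Γ] (hφ : IsApproxAdditive φ) :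
    Monotone hφ.tangentSpace := fun D D' hDD' v hv ε hε => by
  obtain ⟨δ, hδ, h⟩ := hv ε hε
  exact ⟨δ, hδ, fun r hr hrδ => (h r hr hrδ).imp fun d hd => ⟨hDD' hd.1, hd.2⟩⟩

/-- Limits of directions of elements of `D` that converge to `1` are tangent to `D`: the powers of
such elements trace out the ray. -/
lemma mem_tangentSpace_of_direction [IsTopologicalGroup Γ] (hφ : IsApproxAdditive φ)
    {D : Subgroup Γ} {v : E}
    (hv : ∀ ε > 0, ∃ d ∈ D, 0 < ‖φ d‖ ∧ ‖φ d‖ < ε ∧ ‖φ d - ‖φ d‖ • v‖ ≤ ε * ‖φ d‖) :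
    v ∈ hφ.tangentSpace D := by
  intro ε hε
  refine ⟨min (ε / 4) (1 / 4), by positivity, fun r hr hrδ => ?_⟩
  obtain ⟨hr1, hr2⟩ := lt_min_iff.1 hrδ
  obtain ⟨d, hd, ha, had, hdv⟩ := hv (min (ε / 4) (ε * r / (4 * (‖v‖ + 1)))) (by positivity)
  obtain ⟨ha1, ha2⟩ := lt_min_iff.1 had
  rw [lt_div_iff₀ (by positivity)] at ha2
  set a := ‖φ d‖ with haa
  set n := ⌊r / a⌋₊ with hn
  have hn1 : n * a ≤ r := (le_div_iff₀ ha).1 (Nat.floor_le (by positivity))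
  have hn2 : r < (n + 1) * a := (div_lt_iff₀ ha).1 (Nat.lt_floor_add_one _)
  have hp := hφ.norm_map_pow_sub_le d n (by linarith)
  rw [← haa] at hp
  refine ⟨d ^ n, D.pow_mem hd n, ?_⟩
  have h1 : φ (d ^ n) - r • v =
      (φ (d ^ n) - (n : ℝ) • φ d) + ((n : ℝ) • (φ d - a • v) - (r - n * a) • v) := by
    rw [smul_sub, sub_smul, smul_smul]; abel
  rw [h1]
  have h2 := norm_sub_le ((n : ℝ) • (φ d - a • v)) ((r - n * a) • v)
  rw [norm_smul, norm_smul, Real.norm_natCast, Real.norm_of_nonneg (by linarith)] at h2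
  refine (norm_add_le _ _).trans ?_
  have h3 : (n : ℝ) * ‖φ d - a • v‖ ≤ ε / 4 * r := by
    calc (n : ℝ) * ‖φ d - a • v‖ ≤ n * (ε / 4 * a) := by
          gcongr
          exact hdv.trans (mul_le_mul_of_nonneg_right (min_le_left _ _) ha.le)
      _ = ε / 4 * (n * a) := by ring
      _ ≤ ε / 4 * r := by gcongr
  have h4 : (r - n * a) * ‖v‖ ≤ ε * r / 4 := by
    have : (r - n * a) * ‖v‖ ≤ a * ‖v‖ := by gcongr; linarith
    nlinarith
  have h5 : (n * a) ^ 2 ≤ r * (ε / 4) := by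
    have : (n * a) ^ 2 ≤ r ^ 2 := by gcongr
    nlinarith
  have h6 : 0 < ε * r := by positivity
  linarith

/-- The approximation of tangent vectors by group elements is uniform: the error term does not
depend on the subgroup. -/
lemma exists_norm_sub_le_of_mem_tangentSpace [IsTopologicalGroup Γ] (hφ : IsApproxAdditive φ)
    {D : Subgroup Γ} {u : E} (hu : u ∈ hφ.tangentSpace D) (hu1 : ‖u‖ ≤ 1 / 8) :
    ∃ d ∈ D, ‖φ d - u‖ ≤ 2 * ‖u‖ ^ 2 := by
  rcases eq_or_ne u 0 with rfl | hu0
  · exact ⟨1, D.one_mem, by simp [hφ.map_one]⟩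
  set s := ‖u‖ with hs
  have hs0 : 0 < s := norm_pos_iff.2 hu0
  obtain ⟨δ, hδ, h⟩ := hu (s ^ 2 / 4) (by positivity)
  obtain ⟨N, hN⟩ := exists_nat_one_div_lt hδ
  obtain ⟨d, hd, hdu⟩ := h (1 / (N + 1 : ℝ)) (by positivity) hN
  have hd1 : ‖φ d‖ ≤ ‖φ d - (1 / (N + 1 : ℝ)) • u‖ + ‖(1 / (N + 1 : ℝ)) • u‖ := by
    simpa using norm_add_le (φ d - (1 / (N + 1 : ℝ)) • u) ((1 / (N + 1 : ℝ)) • u)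
  rw [norm_smul, Real.norm_of_nonneg (by positivity), ← hs] at hd1
  have hN0 : (0 : ℝ) < N + 1 := by positivity
  have hd2 : (N + 1 : ℝ) * ‖φ d‖ ≤ s ^ 2 / 4 + s := by
    calc (N + 1 : ℝ) * ‖φ d‖ ≤ (N + 1) * (s ^ 2 / 4 * (1 / (N + 1)) + 1 / (N + 1) * s) := by
          gcongr; linarith
      _ = s ^ 2 / 4 + s := by field_simp
  have hp := hφ.norm_map_pow_sub_le d (N + 1) (by push_cast; nlinarith)
  push_cast at hp
  refine ⟨d ^ (N + 1), D.pow_mem hd _, ?_⟩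
  have h1 : φ (d ^ (N + 1)) - u = (φ (d ^ (N + 1)) - ((N : ℝ) + 1) • φ d) +
      ((N : ℝ) + 1) • (φ d - (1 / (N + 1 : ℝ)) • u) := by
    rw [smul_sub, smul_smul, mul_one_div_cancel hN0.ne', one_smul]; abel
  rw [h1]
  refine (norm_add_le _ _).trans ?_
  rw [norm_smul, Real.norm_of_nonneg hN0.le]
  have h2 : (N + 1 : ℝ) * ‖φ d - (1 / (N + 1 : ℝ)) • u‖ ≤ s ^ 2 / 4 := by
    calc (N + 1 : ℝ) * ‖φ d - (1 / (N + 1 : ℝ)) • u‖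
        ≤ (N + 1 : ℝ) * (s ^ 2 / 4 * (1 / (N + 1))) := by gcongr
      _ = s ^ 2 / 4 := by field_simp
  have h3 : ((N + 1 : ℝ) * ‖φ d‖) ^ 2 ≤ (s ^ 2 / 4 + s) ^ 2 := by gcongr
  have h4 : (s ^ 2 / 4 + s) ^ 2 = s ^ 2 * (1 + s / 4) ^ 2 := by ring
  have h5 : (1 + s / 4) ^ 2 ≤ 3 / 2 := by nlinarith
  nlinarith [mul_le_mul_of_nonneg_left h5 (sq_nonneg s)]

/-- In a compact group, a vector that is tangent to all members of a decreasing sequence of closed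
subgroups is tangent to their intersection. -/
lemma iInf_tangentSpace_le [IsTopologicalGroup Γ] [CompactSpace Γ] (hφ : IsApproxAdditive φ)
    {D : ℕ → Subgroup Γ} (hD : Antitone D) (hDc : ∀ k, IsClosed (D k : Set Γ)) :
    ⨅ k, hφ.tangentSpace (D k) ≤ hφ.tangentSpace (⨅ k, D k) := by
  intro v hv
  rw [Submodule.mem_iInf] at hv
  have key : ∀ u : E, (∀ k, u ∈ hφ.tangentSpace (D k)) → ‖u‖ ≤ 1 / 8 →
      ∃ d ∈ ⨅ k, D k, ‖φ d - u‖ ≤ 2 * ‖u‖ ^ 2 := by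
    intro u hu hu1
    have hcl : ∀ k, IsClosed ((D k : Set Γ) ∩ {g | ‖φ g - u‖ ≤ 2 * ‖u‖ ^ 2}) := fun k =>
      (hDc k).inter (hφ.isClosed_norm_sub_le (by nlinarith [norm_nonneg u]))
    obtain ⟨d, hd⟩ := IsCompact.nonempty_iInter_of_sequence_nonempty_isCompact_isClosed
      (fun k => (D k : Set Γ) ∩ {g | ‖φ g - u‖ ≤ 2 * ‖u‖ ^ 2})
      (fun k => Set.inter_subset_inter_left _ (hD (Nat.le_succ k)))
      (fun k => hφ.exists_norm_sub_le_of_mem_tangentSpace (hu k) hu1) (hcl 0).isCompact hcl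
    rw [Set.mem_iInter] at hd
    exact ⟨d, Subgroup.mem_iInf.2 fun k => (hd k).1, (hd 0).2⟩
  intro ε hε
  refine ⟨min (1 / (8 * (‖v‖ + 1))) (ε / (2 * (‖v‖ + 1) ^ 2)), by positivity,
    fun r hr hrδ => ?_⟩
  obtain ⟨h1, h2⟩ := lt_min_iff.1 hrδ
  rw [lt_div_iff₀ (by positivity)] at h1 h2
  have hrv : ‖r • v‖ = r * ‖v‖ := by rw [norm_smul, Real.norm_of_nonneg hr.le]
  obtain ⟨d, hd, hdr⟩ := key (r • v) (fun k => Submodule.smul_mem _ r (hv k))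
    (by rw [hrv]; linarith)
  refine ⟨d, hd, hdr.trans ?_⟩
  rw [hrv]
  have h3 : ‖v‖ ^ 2 ≤ (‖v‖ + 1) ^ 2 := by gcongr; linarith
  have h4 : r * (r * (2 * ‖v‖ ^ 2)) ≤ r * ε := by
    gcongr
    nlinarith
  nlinarith

/-- If two closed subgroups `D' ≤ D` of a compact group have the same tangent space, then `D'`
contains a neighbourhood of `1` in `D`. Otherwise pick elements of `D` near `1` and outside `D'`,
translated by `D'` so as to nearly minimise the norm in their coset. A limit of their directions is
tangent to `D`, hence to `D'`, and translating back along `D'` in that direction decreases the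
norm too much. -/
lemma exists_forall_norm_lt_mem [IsTopologicalGroup Γ] [FiniteDimensional ℝ E]
    (hφ : IsApproxAdditive φ) {D D' : Subgroup Γ} (hDD' : D' ≤ D) (hD' : IsClosed (D' : Set Γ))
    (hT : hφ.tangentSpace D ≤ hφ.tangentSpace D') :
    ∃ ε > 0, ∀ d ∈ D, ‖φ d‖ < ε → d ∈ D' := by
  by_contra! hcon
  -- elements of `D` near `1` that nearly minimise the norm in their coset of `D'`
  have hS : ∀ ε > 0, ∃ s ∈ D, 0 < ‖φ s‖ ∧ ‖φ s‖ < ε ∧ ∀ c ∈ D', ‖φ s‖ ≤ 2 * ‖φ (c * s)‖ := by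
    intro ε hε
    obtain ⟨d, hd, hdε, hdD'⟩ := hcon (ε / 2) (by positivity)
    have hbdd : BddBelow (Set.range fun c : D' => ‖φ (c * d)‖) :=
      ⟨0, by rintro _ ⟨c, rfl⟩; exact norm_nonneg _⟩
    set m := ⨅ c : D', ‖φ (c * d)‖ with hm
    have hm_le : ∀ c ∈ D', m ≤ ‖φ (c * d)‖ := fun c hc => ciInf_le hbdd ⟨c, hc⟩
    have hm0 : 0 < m := by
      have hopen : {g : Γ | d * g⁻¹ ∉ (D' : Set Γ)} ∈ 𝓝 1 :=
        (hD'.isOpen_compl.preimage (f := fun g : Γ => d * g⁻¹) (by fun_prop)).mem_nhds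
          (by simpa using hdD')
      obtain ⟨η, hη, h⟩ := hφ.exists_forall_norm_lt hopen
      refine hη.trans_le (le_ciInf fun c => ?_)
      by_contra! hlt
      exact h _ hlt (by simp)
    obtain ⟨⟨c, hc⟩, hcm⟩ := exists_lt_of_ciInf_lt (show m < 2 * m by linarith)
    have hmd : m ≤ ‖φ d‖ := by simpa using hm_le 1 D'.one_mem
    refine ⟨c * d, D.mul_mem (hDD' hc) hd, hm0.trans_le (hm_le c hc), by dsimp at hcm; linarith,
      fun c' hc' => ?_⟩
    have := hm_le (c' * c) (D'.mul_mem hc' hc)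
    rw [mul_assoc] at this
    dsimp at hcm
    linarith
  choose! s hsD hs0 hsε hmin using hS
  have hpos : ∀ k : ℕ, (0 : ℝ) < 1 / (k + 1) := fun k => by positivity
  set t : ℕ → Γ := fun k => s (1 / (k + 1)) with ht
  have ht0 : ∀ k, 0 < ‖φ (t k)‖ := fun k => hs0 _ (hpos k)
  obtain ⟨v, hv, θ, hθ, hlim⟩ := (isCompact_sphere (0 : E) 1).tendsto_subseq
    (x := fun k => ‖φ (t k)‖⁻¹ • φ (t k)) (fun k => by
      simp [norm_smul, (ht0 k).ne'])
  have hvapprox : ∀ ε > 0, ∃ k, ‖φ (t k)‖ < ε ∧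
      ‖φ (t k) - ‖φ (t k)‖ • v‖ ≤ ε * ‖φ (t k)‖ := by
    intro ε hε
    have hsmall : Tendsto (fun k => 1 / ((θ k : ℝ) + 1)) atTop (𝓝 0) :=
      tendsto_one_div_add_atTop_nhds_zero_nat.comp hθ.tendsto_atTop
    obtain ⟨k, hk1, hk2⟩ := ((hsmall.eventually (gt_mem_nhds hε)).and
      (hlim.eventually (Metric.ball_mem_nhds v hε))).exists
    refine ⟨θ k, (hsε _ (hpos _)).trans hk1, ?_⟩
    have h1 := (ht0 (θ k))
    rw [Function.comp_apply, dist_eq_norm] at hk2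
    have h2 : φ (t (θ k)) - ‖φ (t (θ k))‖ • v =
        ‖φ (t (θ k))‖ • (‖φ (t (θ k))‖⁻¹ • φ (t (θ k)) - v) := by
      rw [smul_sub, smul_smul, mul_inv_cancel₀ h1.ne', one_smul]
    rw [h2, norm_smul, norm_norm, mul_comm]
    gcongr
  have hvD : v ∈ hφ.tangentSpace D := hφ.mem_tangentSpace_of_direction fun ε hε => by
    obtain ⟨k, hk⟩ := hvapprox ε hε
    exact ⟨t k, hsD _ (hpos k), ht0 k, hk⟩
  -- `-v` is tangent to `D'`: multiply `t k`, which is almost `‖φ (t k)‖ • v`, by some `c ∈ D'`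
  -- that almost cancels it
  obtain ⟨δ, hδ, h⟩ := (hφ.mem_tangentSpace.1 ((hφ.tangentSpace D').neg_mem (hT hvD)))
    (1 / 16) (by norm_num)
  obtain ⟨k, hk1, hk2⟩ := hvapprox (min δ (1 / 16)) (by positivity)
  obtain ⟨hk3, hk4⟩ := lt_min_iff.1 hk1
  set r := ‖φ (t k)‖ with hr
  obtain ⟨c, hc, hcr⟩ := h r (ht0 k) hk3
  have h16 : ‖φ (t k) - r • v‖ ≤ 1 / 16 * r :=
    hk2.trans (mul_le_mul_of_nonneg_right (min_le_right _ _) (ht0 k).le)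
  have hsum : ‖φ c + φ (t k)‖ ≤ 1 / 8 * r := by
    have h1 : φ c + φ (t k) = (φ c - r • -v) + (φ (t k) - r • v) := by
      rw [smul_neg]; abel
    rw [h1]
    linarith [norm_add_le (φ c - r • -v) (φ (t k) - r • v)]
  have hcn : ‖φ c‖ ≤ 2 * r := by
    have : ‖φ c‖ ≤ ‖φ c + φ (t k)‖ + ‖φ (t k)‖ := by
      simpa using norm_sub_le (φ c + φ (t k)) (φ (t k))
    linarith [ht0 k]
  have hmul := hφ.norm_map_mul_sub_le c (t k) (by linarith) (by linarith)
  have h2 : ‖φ (c * t k)‖ ≤ ‖φ (c * t k) - φ c - φ (t k)‖ + ‖φ c + φ (t k)‖ := by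
    have : φ (c * t k) = (φ (c * t k) - φ c - φ (t k)) + (φ c + φ (t k)) := by abel
    conv_lhs => rw [this]
    exact norm_add_le _ _
  have h3 : r ≤ 2 * ‖φ (c * t k)‖ := hmin _ (hpos k) c hc
  rw [← hr] at hmul
  nlinarith [ht0 k]

/-! ### The descending chain condition -/

/-- A compact group with an approximately additive map to a finite-dimensional space satisfies the
descending chain condition on closed subgroups. -/
theorem exists_forall_ge_eq_of_antitone [IsTopologicalGroup Γ] [CompactSpace Γ]
    [FiniteDimensional ℝ E] (hφ : IsApproxAdditive φ)
    {D : ℕ → Subgroup Γ} (hD : Antitone D) (hDc : ∀ k, IsClosed (D k : Set Γ)) :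
    ∃ N, ∀ n ≥ N, D n = D N := by
  obtain ⟨N, hN⟩ := WellFoundedGT.monotone_chain_condition
    (⟨fun k => OrderDual.toDual (hφ.tangentSpace (D k)),
      fun a b hab => hφ.tangentSpace_mono (hD hab)⟩ : ℕ →o (Submodule ℝ E)ᵒᵈ)
  have hT : hφ.tangentSpace (D N) ≤ hφ.tangentSpace (⨅ k, D k) := by
    refine le_trans (le_iInf fun k => ?_) (hφ.iInf_tangentSpace_le hD hDc)
    rcases le_total N k with hk | hk
    · exact (OrderDual.toDual.injective (hN k hk)).le
    · exact hφ.tangentSpace_mono (hD hk)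
  have hcl : IsClosed ((⨅ k, D k : Subgroup Γ) : Set Γ) := by
    rw [Subgroup.coe_iInf]
    exact isClosed_iInter hDc
  obtain ⟨ε, hε, h⟩ := hφ.exists_forall_norm_lt_mem (iInf_le D N) hcl hT
  -- the open set of elements that are close to the intersection contains some `D k`
  obtain ⟨V, hV, hVo, h1V⟩ := mem_nhds_iff.1 (hφ.eventually_norm_lt hε)
  have hO : IsOpen (⋃ c : (⨅ k, D k : Subgroup Γ), (fun g : Γ => (c : Γ)⁻¹ * g) ⁻¹' V) :=
    isOpen_iUnion fun c => hVo.preimage (by fun_prop)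
  set O := ⋃ c : (⨅ k, D k : Subgroup Γ), (fun g : Γ => (c : Γ)⁻¹ * g) ⁻¹' V with hOdef
  obtain ⟨k, hk⟩ : ∃ k, (D k : Set Γ) ⊆ O := by
    by_contra! hcon
    have hcl' : ∀ k, IsClosed ((D k : Set Γ) ∩ Oᶜ) := fun k => (hDc k).inter hO.isClosed_compl
    obtain ⟨g, hg⟩ := IsCompact.nonempty_iInter_of_sequence_nonempty_isCompact_isClosed
      (fun k => (D k : Set Γ) ∩ Oᶜ)
      (fun k => Set.inter_subset_inter_left _ (hD (Nat.le_succ k)))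
      (fun k => by
        obtain ⟨g, hg, hgO⟩ := Set.not_subset.1 (hcon k)
        exact ⟨g, hg, hgO⟩) (hcl' 0).isCompact hcl'
    rw [Set.mem_iInter] at hg
    refine (hg 0).2 (Set.mem_iUnion.2 ⟨⟨g, Subgroup.mem_iInf.2 fun k => (hg k).1⟩, ?_⟩)
    simpa using h1V
  have hM : D (max N k) ≤ ⨅ k, D k := by
    intro g hg
    obtain ⟨c, hc⟩ := Set.mem_iUnion.1 (hk (hD (le_max_right N k) hg))
    have h1 : (c : Γ)⁻¹ * g ∈ D N :=
      (D N).mul_mem ((D N).inv_mem (iInf_le D N c.2)) (hD (le_max_left N k) hg)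
    exact (Subgroup.mul_mem_cancel_left _ (inv_mem c.2)).1 (h _ h1 (hV hc))
  exact ⟨max N k, fun n hn => le_antisymm (hD hn) (hM.trans (iInf_le D n))⟩

end Tangent

end IsApproxAdditive

/-! ### Conjugates of subgroups of finite index -/

/-- The descending chain condition for closed subgroups of a compact subgroup `H`. -/
lemma IsApproxAdditive.exists_forall_ge_eq_of_antitone_of_le {Γ E : Type*} [Group Γ]
    [TopologicalSpace Γ] [IsTopologicalGroup Γ] [NormedAddCommGroup E] [NormedSpace ℝ E]
    [FiniteDimensional ℝ E] {H : Subgroup Γ} (hH : IsCompact (H : Set Γ)) {φ : H → E}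
    (hφ : IsApproxAdditive φ) {D : ℕ → Subgroup Γ} (hD : Antitone D)
    (hDc : ∀ k, IsClosed (D k : Set Γ)) (hDH : ∀ k, D k ≤ H) :
    ∃ N, ∀ n ≥ N, D n = D N := by
  have : CompactSpace H := isCompact_iff_compactSpace.1 hH
  obtain ⟨N, hN⟩ := hφ.exists_forall_ge_eq_of_antitone (D := fun k => (D k).subgroupOf H)
    (fun a b hab => Subgroup.comap_mono (hD hab))
    (fun k => (hDc k).preimage continuous_subtype_val)
  refine ⟨N, fun n hn => ?_⟩
  have := congrArg (Subgroup.map H.subtype) (hN n hn)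
  simpa only [Subgroup.subgroupOf_map_subtype, inf_of_le_left (hDH _)] using this

/-- A compact group with an approximately additive map to a finite-dimensional space has a least
closed subgroup of finite index (its identity component). -/
lemma IsApproxAdditive.exists_least_isClosed_relIndex_ne_zero {Γ E : Type*} [Group Γ]
    [TopologicalSpace Γ] [IsTopologicalGroup Γ] [T2Space Γ] [NormedAddCommGroup E]
    [NormedSpace ℝ E] [FiniteDimensional ℝ E] {H : Subgroup Γ} (hH : IsCompact (H : Set Γ))
    {φ : H → E} (hφ : IsApproxAdditive φ) :
    ∃ M ≤ H, IsClosed (M : Set Γ) ∧ M.relIndex H ≠ 0 ∧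
      ∀ M' : Subgroup Γ, IsClosed (M' : Set Γ) → M'.relIndex H ≠ 0 → M ≤ M' := by
  by_contra! hcon
  let P := {M : Subgroup Γ // M ≤ H ∧ IsClosed (M : Set Γ) ∧ M.relIndex H ≠ 0}
  have hstep : ∀ M : P, ∃ M' : P, M'.1 < M.1 := by
    rintro ⟨M, hMH, hMc, hMi⟩
    obtain ⟨M', hMc', hMi', hlt⟩ := hcon M hMH hMc hMi
    exact ⟨⟨M ⊓ M', inf_le_left.trans hMH, hMc.inter hMc', Subgroup.relIndex_inf_ne_zero hMi hMi'⟩,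
      inf_lt_left.2 hlt⟩
  choose f hf using hstep
  let D : ℕ → P := fun k => f^[k] ⟨H, le_rfl, hH.isClosed, by simp⟩
  have hD : StrictAnti fun k => (D k).1 := strictAnti_nat_of_succ_lt fun k => by
    simp only [D, Function.iterate_succ_apply']
    exact hf _
  obtain ⟨N, hN⟩ := hφ.exists_forall_ge_eq_of_antitone_of_le hH hD.antitone
    (fun k => (D k).2.2.1) (fun k => (D k).2.1)
  exact (hD (Nat.lt_succ_self N)).ne (hN (N + 1) (Nat.le_succ N))

/-- The index of a closed subgroup `K` of finite index in `H` does not change when `K` is replaced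
by a conjugate contained in `H`. Indeed, the conjugating element maps the least closed subgroup `M`
of finite index into itself, hence onto itself by the descending chain condition applied to the
iterated conjugates of `M`; so `M` has the same index in `K` and in its conjugate. -/
theorem IsApproxAdditive.relIndex_conj_smul_eq {Γ E : Type*} [Group Γ]
    [TopologicalSpace Γ] [IsTopologicalGroup Γ] [T2Space Γ] [NormedAddCommGroup E]
    [NormedSpace ℝ E] [FiniteDimensional ℝ E] {H : Subgroup Γ} (hH : IsCompact (H : Set Γ))
    {φ : H → E} (hφ : IsApproxAdditive φ) {K : Subgroup Γ} (hKH : K ≤ H)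
    (hK : IsClosed (K : Set Γ)) (hKi : K.relIndex H ≠ 0) {x : Γ} (hx : MulAut.conj x • K ≤ H) :
    (MulAut.conj x • K).relIndex H = K.relIndex H := by
  obtain ⟨M, hMH, hMc, hMi, hM⟩ := hφ.exists_least_isClosed_relIndex_ne_zero hH
  have hMK : M ≤ K := hM K hK hKi
  have hclosed : ∀ (y : Γ), IsClosed ((MulAut.conj y • M : Subgroup Γ) : Set Γ) := by
    intro y
    have : ((MulAut.conj y • M : Subgroup Γ) : Set Γ) = (fun g => y⁻¹ * g * y) ⁻¹' M := by
      ext g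
      rw [SetLike.mem_coe, Subgroup.mem_pointwise_smul_iff_inv_smul_mem, ← map_inv]
      simp [MulAut.smul_def]
    rw [this]
    exact hMc.preimage (by fun_prop)
  set a := MulAut.conj x with ha
  have haM : a • M ≤ M := by
    have haMH : a • M ≤ H := (Subgroup.pointwise_smul_le_pointwise_smul_iff.2 hMK).trans hx
    have h1 : M.relIndex (a • M) ≠ 0 := fun h => hMi (Subgroup.relIndex_eq_zero_of_le_right haMH h)
    have h2 : (a⁻¹ • M).relIndex M ≠ 0 := by
      rwa [← Subgroup.relIndex_pointwise_smul a, smul_inv_smul]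
    have h3 : (a⁻¹ • M ⊓ M).relIndex H ≠ 0 :=
      Subgroup.relIndex_ne_zero_trans (by rwa [Subgroup.inf_relIndex_right]) hMi
    have h4 := hM _ (by
      rw [ha, ← map_inv]
      exact (hclosed x⁻¹).inter hMc) h3
    exact Subgroup.subset_pointwise_smul_iff.1 (by simpa using h4.trans inf_le_left)
  have hanti : Antitone fun k : ℕ => a ^ k • M := antitone_nat_of_succ_le fun k => by
    rw [pow_succ, mul_smul]
    exact Subgroup.pointwise_smul_le_pointwise_smul_iff.2 haM
  obtain ⟨N, hN⟩ := hφ.exists_forall_ge_eq_of_antitone_of_le hH hanti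
    (fun k => by
      rw [ha, ← map_pow]
      exact hclosed _)
    (fun k => (hanti (Nat.zero_le k)).trans (by simpa using hMH))
  have haM' : a • M = M := by
    have := hN (N + 1) (Nat.le_succ N)
    simp only [pow_succ, mul_smul] at this
    exact smul_left_cancel _ this
  have hMKi : M.relIndex K ≠ 0 := fun h => hMi (Subgroup.relIndex_eq_zero_of_le_right hKH h)
  have h5 := Subgroup.relIndex_mul_relIndex M K H hMK hKH
  have h6 := Subgroup.relIndex_mul_relIndex M (a • K) H
    (haM'.ge.trans (Subgroup.pointwise_smul_le_pointwise_smul_iff.2 hMK)) hx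
  have h7 : M.relIndex (a • K) = M.relIndex K := by
    conv_lhs => rw [← haM']
    exact Subgroup.relIndex_pointwise_smul a M K
  rw [h7, ← h5] at h6
  exact Nat.eq_of_mul_eq_mul_left (Nat.pos_of_ne_zero hMKi) h6

/-! ### Charts of Lie groups -/

/-- A `C²` operation with two-sided unit `0` is addition up to a bilinear error. -/
lemma ContDiffAt.exists_norm_sub_add_le {E : Type*} [NormedAddCommGroup E] [NormedSpace ℝ E]
    {m : E × E → E} (hm : ContDiffAt ℝ 2 m 0) (hm₁ : ∀ᶠ x in 𝓝 0, m (x, 0) = x)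
    (hm₂ : ∀ᶠ y in 𝓝 0, m (0, y) = y) :
    ∃ C > 0, ∃ δ > 0, ∀ x y, ‖x‖ < δ → ‖y‖ < δ → ‖m (x, y) - x - y‖ ≤ C * (‖x‖ * ‖y‖) := by
  have hm' : ContDiffAt ℝ 1 (fderiv ℝ m) 0 := hm.fderiv_right (by norm_num)
  obtain ⟨K, t, ht, hK⟩ := hm'.exists_lipschitzOnWith
  have hdiff : ∀ᶠ p in 𝓝 (0 : E × E), DifferentiableAt ℝ m p :=
    (hm.eventually (by simp)).mono fun p hp => hp.differentiableAt (by simp)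
  obtain ⟨δ₁, hδ₁, h₁⟩ := Metric.eventually_nhds_iff_ball.1 (hdiff.and ht)
  obtain ⟨δ₂, hδ₂, h₂⟩ := Metric.eventually_nhds_iff_ball.1 (hm₁.and hm₂)
  refine ⟨K + 1, by positivity, min δ₁ δ₂, by positivity, fun x y hx hy => ?_⟩
  have hmem : ∀ z ∈ Metric.ball (0 : E) (min δ₁ δ₂), ∀ w : E, ‖w‖ < min δ₁ δ₂ →
      (z, w) ∈ Metric.ball (0 : E × E) δ₁ := by
    intro z hz w hw
    rw [mem_ball_zero_iff] at hz ⊢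
    exact (max_lt hz hw).trans_le (min_le_left _ _)
  have hder : ∀ z ∈ Metric.ball (0 : E) (min δ₁ δ₂), ∀ w : E, ‖w‖ < min δ₁ δ₂ →
      HasFDerivAt (fun z => m (z, w)) ((fderiv ℝ m (z, w)).comp (.inl ℝ E E)) z := by
    intro z hz w hw
    exact (h₁ _ (hmem z hz w hw)).1.hasFDerivAt.comp z (hasFDerivAt_prodMk_left z w)
  have h0 : ‖(0 : E)‖ < min δ₁ δ₂ := by rw [norm_zero]; positivity
  have hid : ∀ z ∈ Metric.ball (0 : E) (min δ₁ δ₂),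
      (fderiv ℝ m (z, 0)).comp (.inl ℝ E E) = .id ℝ E := by
    intro z hz
    refine (hder z hz 0 h0).unique ((hasFDerivAt_id z).congr_of_eventuallyEq ?_)
    filter_upwards [Metric.isOpen_ball.mem_nhds hz] with z' hz'
    exact (h₂ z' (Metric.ball_subset_ball (min_le_right _ _) hz')).1
  have hbound : ∀ z ∈ Metric.ball (0 : E) (min δ₁ δ₂),
      ‖(fderiv ℝ m (z, y)).comp (.inl ℝ E E) - .id ℝ E‖ ≤ K * ‖y‖ := by
    intro z hz
    rw [← hid z hz, ← ContinuousLinearMap.sub_comp]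
    refine (ContinuousLinearMap.opNorm_comp_le _ _).trans ?_
    have h3 := hK.norm_sub_le (h₁ _ (hmem z hz y hy)).2 (h₁ _ (hmem z hz 0 h0)).2
    have h4 : ‖(z, y) - (z, (0 : E))‖ = ‖y‖ := by simp [Prod.norm_def]
    rw [h4] at h3
    calc _ ≤ (K * ‖y‖) * 1 := by
          gcongr
          exact ContinuousLinearMap.norm_inl_le_one ℝ E E
      _ = _ := mul_one _
  -- mean value inequality for `z ↦ m (z, y) - z`, whose derivative vanishes for `y = 0`
  have hmv : ‖m (x, y) - x - (m (0, y) - 0)‖ ≤ K * ‖y‖ * ‖x - 0‖ :=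
    (convex_ball (0 : E) (min δ₁ δ₂)).norm_image_sub_le_of_norm_hasFDerivWithin_le
    (f := fun z => m (z, y) - z)
    (fun z hz => ((hder z hz y hy).sub (hasFDerivAt_id z)).hasFDerivWithinAt) hbound
    (mem_ball_zero_iff.2 h0) (mem_ball_zero_iff.2 hx)
  have h5 : m (0, y) = y :=
    (h₂ y (mem_ball_zero_iff.2 (hy.trans_le (min_le_right _ _)))).2
  rw [h5, sub_zero, sub_zero] at hmv
  refine hmv.trans ?_
  nlinarith [norm_nonneg x, norm_nonneg y, mul_nonneg (norm_nonneg x) (norm_nonneg y)]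

/-- A chart around `1` of a Lie group, rescaled and with values off its domain moved away from
`0` along an additional coordinate, is an approximately additive map. -/
theorem IsRealLieGroup.exists_isApproxAdditive {L : Type*} [Group L] [TopologicalSpace L]
    (hL : IsRealLieGroup L) :
    ∃ (n : ℕ) (φ : L → EuclideanSpace ℝ (Fin n) × ℝ), IsApproxAdditive φ := by
  obtain ⟨n, _, _⟩ := hL
  have : IsTopologicalGroup L := topologicalGroup_of_lieGroup 𝓘(ℝ, EuclideanSpace ℝ (Fin n)) ∞
  set E := EuclideanSpace ℝ (Fin n) with hE
  let e : OpenPartialHomeomorph L E := chartAt E (1 : L)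
  have h1e : (1 : L) ∈ e.source := mem_chart_source E 1
  have h1t : e 1 ∈ e.target := e.map_source h1e
  -- the multiplication in the chart
  let s : E → L := fun x => e.symm (x + e 1)
  have hs0 : s 0 = 1 := by simp [s, e.left_inv h1e]
  have hs : ∀ g ∈ e.source, s (e g - e 1) = g := fun g hg => by simp [s, e.left_inv hg]
  have hsc : Tendsto s (𝓝 0) (𝓝 1) := by
    have h1 : Tendsto (fun x : E => x + e 1) (𝓝 0) (𝓝 (e 1)) := by
      have : Continuous fun x : E => x + e 1 := by fun_prop
      simpa using this.tendsto 0
    have h2 := e.symm.continuousAt (x := e 1) h1t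
    rw [ContinuousAt, e.left_inv h1e] at h2
    exact h2.comp h1
  have hes : ∀ᶠ x in 𝓝 (0 : E), e (s x) - e 1 = x := by
    have : Continuous fun x : E => x + e 1 := by fun_prop
    filter_upwards [this.continuousAt.eventually (e.open_target.mem_nhds (by simpa using h1t))]
      with x hx
    simp only [s]
    rw [e.right_inv hx, add_sub_cancel_right]
  let m : E × E → E := fun p => e (s p.1 * s p.2) - e 1
  have hsm : ContMDiffAt 𝓘(ℝ, E) 𝓘(ℝ, E) ∞ s 0 := by
    have h1 : ContMDiffAt 𝓘(ℝ, E) 𝓘(ℝ, E) ∞ e.symm (0 + e 1) :=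
      (contMDiffOn_chart_symm (I := 𝓘(ℝ, E)) (n := ∞) (x := (1 : L))).contMDiffAt
        (e.open_target.mem_nhds (by simpa using h1t))
    exact h1.comp (0 : E) (contDiff_id.add contDiff_const).contMDiff.contMDiffAt
  have hm : ContDiffAt ℝ 2 m 0 := by
    have h1 : ContMDiffAt 𝓘(ℝ, E × E) 𝓘(ℝ, E) ∞ (fun p : E × E => s p.1 * s p.2) 0 :=
      (hsm.comp (0 : E × E) contDiff_fst.contMDiff.contMDiffAt).mul
        (hsm.comp (0 : E × E) contDiff_snd.contMDiff.contMDiffAt)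
    have h2 : ContMDiffAt 𝓘(ℝ, E) 𝓘(ℝ, E) ∞ e (s (0 : E × E).1 * s (0 : E × E).2) :=
      (contMDiffOn_chart (I := 𝓘(ℝ, E)) (n := ∞) (x := (1 : L))).contMDiffAt
        (e.open_source.mem_nhds (by simpa [hs0] using h1e))
    have h3 := (contMDiffAt_iff_contDiffAt.1 (h2.comp (0 : E × E) h1)).sub
      (contDiffAt_const (c := e 1))
    exact h3.of_le (WithTop.coe_le_coe.2 le_top)
  obtain ⟨C, hC, δ₁, hδ₁, hCm⟩ := hm.exists_norm_sub_add_le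
    (by simpa [m, hs0] using hes) (by simpa [m, hs0] using hes)
  have hsrc : ∀ᶠ p in 𝓝 (0 : E × E), s p.1 * s p.2 ∈ e.source := by
    have h1 : Tendsto (fun p : E × E => s p.1 * s p.2) (𝓝 0) (𝓝 (1 * 1)) :=
      (hsc.comp (continuous_fst.tendsto (0 : E × E))).mul
        (hsc.comp (continuous_snd.tendsto (0 : E × E)))
    exact h1.eventually (e.open_source.mem_nhds (by simpa using h1e))
  obtain ⟨δ₂, hδ₂, hsrc⟩ := Metric.eventually_nhds_iff_ball.1 hsrc
  -- rescaling by `c` makes the constant at most `1` and the domain contain the unit ball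
  obtain ⟨c, hc⟩ := exists_gt (max C (max (1 / δ₁) (1 / δ₂)))
  simp only [max_lt_iff] at hc
  obtain ⟨hc1, hc2, hc3⟩ := hc
  have hc0 : 0 < c := hC.trans hc1
  rw [div_lt_iff₀ (by positivity)] at hc2 hc3
  classical
  let φ : L → E × ℝ := fun g => if g ∈ e.source then (c • (e g - e 1), 0) else (0, 2)
  have hφs : ∀ g ∈ e.source, φ g = (c • (e g - e 1), 0) := fun g hg => if_pos hg
  have hφn : ∀ g ∈ e.source, ‖φ g‖ = c * ‖e g - e 1‖ := fun g hg => by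
    rw [hφs g hg, Prod.norm_def, norm_zero, norm_smul, Real.norm_of_nonneg hc0.le]
    exact max_eq_left (by positivity)
  have hφ1 : ∀ g, ‖φ g‖ ≤ 1 → g ∈ e.source := fun g hg => by
    by_contra hgs
    have : φ g = (0, 2) := if_neg hgs
    rw [this, Prod.norm_def] at hg
    norm_num at hg
  refine ⟨n, φ, ⟨le_antisymm ?_ ?_, fun g h hg hh => ?_⟩⟩
  · rw [← tendsto_iff_comap]
    have h1 : Tendsto (fun g => (c • (e g - e 1), (0 : ℝ))) (𝓝 1) (𝓝 (0 : E × ℝ)) := by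
      have h2 : ContinuousAt (fun g => (c • (e g - e 1), (0 : ℝ))) 1 := by
        have := e.continuousAt h1e
        fun_prop
      simpa [Prod.mk_zero_zero] using h2.tendsto
    refine h1.congr' ?_
    filter_upwards [e.open_source.mem_nhds h1e] with g hg
    exact (hφs g hg).symm
  · intro V hV
    obtain ⟨η, hη, hηV⟩ := Metric.eventually_nhds_iff_ball.1 (hsc.eventually hV)
    refine mem_comap.2 ⟨Metric.ball 0 (min 1 (c * η)), Metric.ball_mem_nhds _ (by positivity),
      fun g hg => ?_⟩
    rw [Set.mem_preimage, mem_ball_zero_iff, lt_min_iff] at hg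
    have hgs := hφ1 g hg.1.le
    rw [hφn g hgs] at hg
    have := hηV (e g - e 1) (mem_ball_zero_iff.2 (lt_of_mul_lt_mul_left hg.2 hc0.le))
    rwa [hs g hgs] at this
  · have hgs := hφ1 g hg
    have hhs := hφ1 h hh
    rw [hφn g hgs] at hg ⊢
    rw [hφn h hhs] at hh ⊢
    have hlt : ∀ {a δ : ℝ}, 1 < c * δ → c * a ≤ 1 → a < δ := fun h1 h2 =>
      lt_of_mul_lt_mul_left (h2.trans_lt h1) hc0.le
    have hgh : g * h ∈ e.source := by
      have := hsrc (e g - e 1, e h - e 1)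
        (mem_ball_zero_iff.2 (max_lt (hlt hc3 hg) (hlt hc3 hh)))
      simpa only [hs g hgs, hs h hhs] using this
    have hb := hCm _ _ (hlt hc2 hg) (hlt hc2 hh)
    simp only [m, hs g hgs, hs h hhs] at hb
    rw [hφs _ hgh, hφs g hgs, hφs h hhs, Prod.mk_sub_mk, Prod.mk_sub_mk, Prod.norm_def,
      ← smul_sub, ← smul_sub, norm_smul, Real.norm_of_nonneg hc0.le]
    simp only [sub_zero, norm_zero]
    refine max_le ?_ (by positivity)
    calc _ ≤ c * (c * (‖e g - e 1‖ * ‖e h - e 1‖)) := by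
          gcongr
          exact hb.trans (by gcongr)
      _ = _ := by ring

/-! ### Coset spaces of compact metrizable groups -/

/-- An infinite coset space of a closed subgroup of a compact metrizable group has the cardinality
of the continuum: it is an uncountable Polish space, as otherwise some coset would have interior by
Baire's theorem and the subgroup would be open. -/
theorem mk_quotient_eq_continuum_of_infinite {Γ : Type*} [Group Γ] [TopologicalSpace Γ]
    [IsTopologicalGroup Γ] [CompactSpace Γ] [T2Space Γ] [SecondCountableTopology Γ]
    {K : Subgroup Γ} (hK : IsClosed (K : Set Γ)) [Infinite (Γ ⧸ K)] :
    Cardinal.mk (Γ ⧸ K) = Cardinal.continuum := by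
  have hunc : ¬ Countable (Γ ⧸ K) := by
    intro hcount
    obtain ⟨q, g, hg⟩ := nonempty_interior_of_iUnion_of_closed
      (f := fun q : Γ ⧸ K => (QuotientGroup.mk : Γ → Γ ⧸ K) ⁻¹' {q})
      (fun q => isClosed_singleton.preimage QuotientGroup.continuous_mk)
      (Set.iUnion_eq_univ_iff.2 fun g => ⟨g, rfl⟩)
    have hgq : (QuotientGroup.mk g : Γ ⧸ K) = q :=
      interior_subset (s := (QuotientGroup.mk : Γ → Γ ⧸ K) ⁻¹' {q}) hg
    have hnhds : (K : Set Γ) ∈ 𝓝 (1 : Γ) := by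
      have h1 : Tendsto (fun k : Γ => g * k) (𝓝 1) (𝓝 g) := by
        have : Continuous fun k : Γ => g * k := by fun_prop
        simpa using this.tendsto 1
      filter_upwards [h1.eventually (mem_interior_iff_mem_nhds.1 hg)] with k hk
      have hk' : (QuotientGroup.mk g : Γ ⧸ K) = QuotientGroup.mk (g * k) :=
        hgq.trans (show _ = q from hk).symm
      simpa using QuotientGroup.eq.1 hk'
    have := Subgroup.quotient_finite_of_isOpen K (K.isOpen_of_mem_nhds hnhds)
    exact not_finite (Γ ⧸ K)
  let _ : MetricSpace (Γ ⧸ K) := TopologicalSpace.metrizableSpaceMetric (Γ ⧸ K)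
  have : PolishSpace (Γ ⧸ K) := inferInstance
  borelize (Γ ⧸ K)
  have h := Cardinal.mk_congr_lift.{_, 0}
    (PolishSpace.measurableEquivNatBoolOfNotCountable hunc).toEquiv
  simpa using h

/-! ### The index as a cardinal, and the index condition -/

section CardIndex

variable {G : Type*} [Group G] {H K : Subgroup G}

lemma cardIndex_eq_relIndex (h : K.relIndex H ≠ 0) : cardIndex H K = K.relIndex H := by
  have : Finite (H ⧸ K.subgroupOf H) := Nat.finite_of_card_ne_zero h
  rw [cardIndex, ← Nat.cast_card]
  rfl

variable [TopologicalSpace G] [IsTopologicalGroup G] [PolishSpace G]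

lemma cardIndex_eq_continuum (hH : IsCompact (H : Set G)) (hK : IsClosed (K : Set G))
    (h : K.relIndex H = 0) : cardIndex H K = Cardinal.continuum := by
  have : CompactSpace H := isCompact_iff_compactSpace.1 hH
  have : SecondCountableTopology H :=
    TopologicalSpace.Subtype.secondCountableTopology (H : Set G)
  have : Infinite (H ⧸ K.subgroupOf H) := Subgroup.index_eq_zero_iff_infinite.1 h
  exact mk_quotient_eq_continuum_of_infinite (hK.preimage continuous_subtype_val)

lemma cardIndex_mem_posNatOrContinuum (hH : IsCompact (H : Set G)) (hK : IsClosed (K : Set G)) :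
    cardIndex H K ∈ posNatOrContinuum := by
  by_cases h : K.relIndex H = 0
  · exact Or.inr (cardIndex_eq_continuum hH hK h)
  · exact Or.inl ⟨_, Nat.pos_of_ne_zero h, cardIndex_eq_relIndex h⟩

end CardIndex

lemma conjSubgroup_eq_smul {G : Type*} [Group G] (x : G) (H : Subgroup G) :
    conjSubgroup x H = MulAut.conj x • H := rfl

lemma conj_inv_smul_inf_conjSubgroup {G : Type*} [Group G] (x : G) (H : Subgroup G) :
    MulAut.conj x⁻¹ • (H ⊓ conjSubgroup x H) = H ⊓ conjSubgroup x⁻¹ H := by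
  rw [conjSubgroup_eq_smul, conjSubgroup_eq_smul, Subgroup.smul_inf, map_inv, inv_smul_smul,
    inf_comm]

lemma isClosed_inf_conjSubgroup {G : Type*} [Group G] [TopologicalSpace G] [IsTopologicalGroup G]
    [T2Space G] {H : Subgroup G} (hH : IsCompact (H : Set G)) (x : G) :
    IsClosed ((H ⊓ conjSubgroup x H : Subgroup G) : Set G) := by
  refine hH.isClosed.inter (IsCompact.isClosed ?_)
  exact hH.image (f := fun g => x * g * x⁻¹) (by fun_prop)

/-- It suffices to compare finite indices, one inequality at a time. -/
lemma indexCondition_of_relIndex_le {G : Type*} [Group G] [TopologicalSpace G]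
    [IsTopologicalGroup G] [PolishSpace G] {H : Subgroup G} (hH : IsCompact (H : Set G))
    (h : ∀ x : G, (H ⊓ conjSubgroup x H).relIndex H ≠ 0 →
      (H ⊓ conjSubgroup x⁻¹ H).relIndex H ≠ 0 ∧
      (H ⊓ conjSubgroup x⁻¹ H).relIndex H ≤ (H ⊓ conjSubgroup x H).relIndex H) :
    IndexCondition H := by
  intro x
  have h' := h x⁻¹
  rw [inv_inv] at h'
  by_cases hx : (H ⊓ conjSubgroup x H).relIndex H = 0
  · have hx' : (H ⊓ conjSubgroup x⁻¹ H).relIndex H = 0 := by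
      by_contra hne
      exact (h' hne).1 hx
    rw [cardIndex_eq_continuum hH (isClosed_inf_conjSubgroup hH x) hx,
      cardIndex_eq_continuum hH (isClosed_inf_conjSubgroup hH x⁻¹) hx']
  · obtain ⟨h1, h2⟩ := h x hx
    rw [cardIndex_eq_relIndex hx, cardIndex_eq_relIndex h1, le_antisymm h2 (h' h1).2]

/-! ### Passage to the limit -/

/-- Let `p i` be homomorphisms with trivial common kernel and with a downward directed family of
kernels, and let `K ≤ H` with `K` compact. If the indices of the images of `K` in those of `H` are
finite and bounded, the index of `K` in `H` is one of them. Indeed, the preimages of the images of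
`K` are a directed family with intersection `K`, by compactness, and the trace on `H` of a member
of maximal index lies in all others. -/
theorem Subgroup.exists_relIndex_eq_relIndex_map {G ι : Type*} [Group G] [TopologicalSpace G]
    [IsTopologicalGroup G] [T2Space G] [Nonempty ι] {L : ι → Type*} [∀ i, Group (L i)]
    [∀ i, TopologicalSpace (L i)] [∀ i, T2Space (L i)]
    (p : ∀ i, G →* L i) (hp : ∀ i, Continuous (p i))
    (hdir : ∀ i j, ∃ k, (p k).ker ≤ (p i).ker ∧ (p k).ker ≤ (p j).ker)
    (hker : ∀ g, (∀ i, p i g = 1) → g = 1)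
    {H K : Subgroup G} (hKH : K ≤ H) (hK : IsCompact (K : Set G)) {n : ℕ}
    (h0 : ∀ i, (K.map (p i)).relIndex (H.map (p i)) ≠ 0)
    (hn : ∀ i, (K.map (p i)).relIndex (H.map (p i)) ≤ n) :
    ∃ i, K.relIndex H = (K.map (p i)).relIndex (H.map (p i)) := by
  simp only [← Subgroup.relIndex_comap, Subgroup.comap_map_eq] at h0 hn ⊢
  let N : ι → Subgroup G := fun i => K ⊔ (p i).ker
  have hinf : ∀ g, (∀ i, g ∈ N i) → g ∈ K := by
    intro g hg
    have hmem : ∀ i, ∃ k ∈ K, p i k = p i g := fun i => by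
      have : g ∈ K ⊔ (p i).ker := hg i
      rwa [← Subgroup.comap_map_eq, Subgroup.mem_comap, Subgroup.mem_map] at this
    have hcl : ∀ i, IsClosed {k | p i k = p i g} := fun i => isClosed_eq (hp i) continuous_const
    obtain ⟨k, hk⟩ := IsCompact.nonempty_iInter_of_directed_nonempty_isCompact_isClosed
      (fun i => (K : Set G) ∩ {k | p i k = p i g})
      (fun i j => by
        obtain ⟨k, hki, hkj⟩ := hdir i j
        have hsub : ∀ l, (p k).ker ≤ (p l).ker →
            (K : Set G) ∩ {d | p k d = p k g} ⊆ (K : Set G) ∩ {d | p l d = p l g} :=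
          fun l hl d hd => ⟨hd.1, (MonoidHom.eq_iff (p l)).2
            (hl ((MonoidHom.eq_iff (p k)).1 hd.2))⟩
        exact ⟨k, hsub i hki, hsub j hkj⟩)
      (fun i => (hmem i).imp fun k hk => ⟨hk.1, hk.2⟩)
      (fun i => hK.inter_right (hcl i)) (fun i => hK.isClosed.inter (hcl i))
    rw [Set.mem_iInter] at hk
    have hkg : k⁻¹ * g = 1 := hker _ fun i => by
      rw [map_mul, map_inv, (hk i).2, inv_mul_cancel]
    rw [← inv_mul_eq_one.1 hkg]
    exact (hk (Classical.arbitrary ι)).1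
  -- a member of maximal index
  obtain ⟨i, hi⟩ : ∃ i, ∀ j, (N j).relIndex H ≤ (N i).relIndex H := by
    have hfin : (Set.range fun i => (N i).relIndex H).Finite :=
      (Set.finite_Iic n).subset (by rintro _ ⟨i, rfl⟩; exact hn i)
    obtain ⟨_, ⟨i, rfl⟩, hi⟩ := hfin.exists_maximal (Set.range_nonempty _)
    exact ⟨i, fun j => (le_total _ _).elim id fun h => hi ⟨j, rfl⟩ h⟩
  refine ⟨i, ?_⟩
  have hle : N i ⊓ H ≤ K := by
    intro g hg
    refine hinf g fun j => ?_
    obtain ⟨k, hki, hkj⟩ := hdir i j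
    have hNki : N k ≤ N i := sup_le_sup_left hki K
    have hmul := Subgroup.relIndex_mul_relIndex (N k ⊓ H) (N i ⊓ H) H
      (inf_le_inf_right H hNki) inf_le_right
    rw [Subgroup.inf_relIndex_right, Subgroup.inf_relIndex_right] at hmul
    have heq : (N k).relIndex H = (N i).relIndex H :=
      le_antisymm (hi k) (Subgroup.relIndex_le_of_le_left hNki (h0 k))
    rw [heq, Nat.mul_eq_right (h0 i), Subgroup.relIndex_eq_one] at hmul
    exact (sup_le_sup_left hkj K : N k ≤ N j) (hmul hg).1
  rw [← Subgroup.inf_relIndex_right (N i) H, le_antisymm hle (le_inf le_sup_left hKH)]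

/-- The comparison of indices in a group with enough homomorphisms to Lie groups: it holds in each
of these Lie groups, and the index of a compact subgroup is attained in one of them. -/
theorem relIndex_inf_conjSubgroup_le_of_lieGroups {G ι : Type*} [Group G] [TopologicalSpace G]
    [IsTopologicalGroup G] [T2Space G] [Nonempty ι] {L : ι → Type*} [∀ i, Group (L i)]
    [∀ i, TopologicalSpace (L i)] (hL : ∀ i, IsRealLieGroup (L i))
    (p : ∀ i, G →* L i) (hp : ∀ i, Continuous (p i))
    (hdir : ∀ i j, ∃ k, (p k).ker ≤ (p i).ker ∧ (p k).ker ≤ (p j).ker)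
    (hker : ∀ g, (∀ i, p i g = 1) → g = 1)
    {H : Subgroup G} (hH : IsCompact (H : Set G)) (x : G)
    (hx : (H ⊓ conjSubgroup x H).relIndex H ≠ 0) :
    (H ⊓ conjSubgroup x⁻¹ H).relIndex H ≠ 0 ∧
      (H ⊓ conjSubgroup x⁻¹ H).relIndex H ≤ (H ⊓ conjSubgroup x H).relIndex H := by
  have htop : ∀ i, IsTopologicalGroup (L i) := fun i => by
    obtain ⟨n, _, _⟩ := hL i
    exact topologicalGroup_of_lieGroup 𝓘(ℝ, EuclideanSpace ℝ (Fin n)) ∞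
  have hT2 : ∀ i, T2Space (L i) := fun i => by
    obtain ⟨n, _, _⟩ := hL i
    have : T1Space (L i) := ChartedSpace.t1Space (EuclideanSpace ℝ (Fin n)) (L i)
    infer_instance
  set K := H ⊓ conjSubgroup x H with hKdef
  set K' := H ⊓ conjSubgroup x⁻¹ H with hK'def
  have hKK' : MulAut.conj x⁻¹ • K = K' := conj_inv_smul_inf_conjSubgroup x H
  have hKc : IsCompact (K : Set G) :=
    hH.of_isClosed_subset (isClosed_inf_conjSubgroup hH x) inf_le_left
  have hK'c : IsCompact (K' : Set G) :=
    hH.of_isClosed_subset (isClosed_inf_conjSubgroup hH x⁻¹) inf_le_left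
  have hKi : ∀ i, (K.map (p i)).relIndex (H.map (p i)) ≠ 0 ∧
      (K.map (p i)).relIndex (H.map (p i)) ≤ K.relIndex H := fun i => by
    rw [← Subgroup.relIndex_comap]
    have hle := Subgroup.le_comap_map (p i) K
    exact ⟨fun h => hx (Subgroup.relIndex_eq_zero_of_le_left hle h),
      Subgroup.relIndex_le_of_le_left hle hx⟩
  have hK'i : ∀ i, (K'.map (p i)).relIndex (H.map (p i)) =
      (K.map (p i)).relIndex (H.map (p i)) := fun i => by
    have hmap : K'.map (p i) = MulAut.conj (p i x)⁻¹ • K.map (p i) := by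
      rw [← hKK', ← conjSubgroup_eq_smul, ← conjSubgroup_eq_smul, conjSubgroup, conjSubgroup,
        Subgroup.map_map, Subgroup.map_map]
      congr 1
      ext g
      simp
    obtain ⟨n, φ, hφ⟩ := (hL i).exists_isApproxAdditive
    have hle := Subgroup.map_mono (f := p i) (show K' ≤ H from inf_le_left)
    rw [hmap] at hle ⊢
    exact (hφ.subgroup (H.map (p i))).relIndex_conj_smul_eq (hH.image (hp i))
      (Subgroup.map_mono inf_le_left) (hKc.image (hp i)).isClosed (hKi i).1 hle
  obtain ⟨i, hi⟩ := Subgroup.exists_relIndex_eq_relIndex_map p hp hdir hker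
    (show K' ≤ H from inf_le_left) hK'c (fun i => hK'i i ▸ (hKi i).1)
    (fun i => hK'i i ▸ (hKi i).2)
  rw [hi, hK'i i]
  exact hKi i

theorem theorem1p2 {G : Type u} [Group G] [TopologicalSpace G] [IsTopologicalGroup G]
    [PolishSpace G] (H : Subgroup G) (hH : IsCompact (H : Set G)) :
    (IsInverseLimitOfLieGroups.{u, v, w} G →
      IndexCondition H ∧
      ∀ x : G, cardIndex H (H ⊓ conjSubgroup x H) ∈ posNatOrContinuum ∧
        cardIndex H (H ⊓ conjSubgroup x⁻¹ H) ∈ posNatOrContinuum) ∧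
    (IsRealLieGroup H → IndexCondition H) := by
  refine ⟨fun hG => ⟨indexCondition_of_relIndex_le hH ?_, fun x =>
    ⟨cardIndex_mem_posNatOrContinuum hH (isClosed_inf_conjSubgroup hH x),
      cardIndex_mem_posNatOrContinuum hH (isClosed_inf_conjSubgroup hH x⁻¹)⟩⟩,
    fun hL => indexCondition_of_relIndex_le hH fun x hx => ?_⟩
  · obtain ⟨ι, _, L, _, _, f, _, hdir, hL, -, -, ⟨e⟩⟩ := hG
    let p : ∀ i, G →* L i := fun i =>
      ((Pi.evalMonoidHom L i).comp (inverseLimit L f).subtype).comp e.toMulEquiv.toMonoidHom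
    have hpe : ∀ i g, p i g = (e g : ∀ i, L i) i := fun i g => rfl
    have hp : ∀ i, Continuous (p i) := fun i =>
      (continuous_apply i).comp (continuous_subtype_val.comp e.continuous_toFun)
    have hmono : ∀ i k, i ≤ k → (p k).ker ≤ (p i).ker := fun i k hik g hg => by
      rw [MonoidHom.mem_ker, hpe] at hg ⊢
      rw [← (e g).2 hik, hg, map_one]
    refine relIndex_inf_conjSubgroup_le_of_lieGroups hL p hp (fun i j => ?_) (fun g hg => ?_) hH
    · obtain ⟨k, hik, hjk⟩ := hdir.directed i j
      exact ⟨k, hmono i k hik, hmono j k hjk⟩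
    · refine e.injective ?_
      rw [map_one]
      exact Subtype.ext (funext hg)
  · obtain ⟨n, φ, hφ⟩ := hL.exists_isApproxAdditive
    have heq := hφ.relIndex_conj_smul_eq hH (K := H ⊓ conjSubgroup x H) inf_le_left
      (isClosed_inf_conjSubgroup hH x) hx (x := x⁻¹) (by
        rw [conj_inv_smul_inf_conjSubgroup]
        exact inf_le_left)
    rw [conj_inv_smul_inf_conjSubgroup] at heq
    rw [heq]
    exact ⟨hx, le_rfl⟩
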